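/- Consider the synchronous message passing model: the network is an $n$-vertex graph $G=(V,E)$ whose vertices carry the distinct identity numbers $1,\dots,n$; initially a vertex knows its own identity number and the global parameters ($n$, $\varepsilon$, and the numbers $a,k,t$ below), in each round it sends a message of arbitrary size to its neighbors and performs arbitrary local computation, and the running time is the number of rounds until every vertex has irrevocably fixed its output. The arboricity of a graph is the minimal number of edge-disjoint forests that cover its edge set. An $r$-arbdefective $k$-coloring is a coloring with the colors $1,\dots,k$ such that each color class induces a subgraph of arboricity at most $r$. All logarithms are to base $2$. Procedure Arbdefective-Coloring, with positive integer parameters $k$ and $t$, works on a graph $G$ of arboricity at most $a$ as follows. 1. *Partial-Orientation.* (i) A subroutine computes an H-partition, that is, a partition $V=H_1\cup\dots\cup H_\ell$ with $\ell=O(\log n)$ such that each $v\in H_i$ has at most $\lfloor(2+\varepsilon)a\rfloor$ neighbors in $H_i\cup\dots\cup H_\ell$. (ii) A subroutine, run in parallel on all induced subgraphs $G(H_i)$, computes a $\lfloor a/t\rfloor$-defective $O(t^2)$-coloring of each of them, that is, a coloring with $O(t^2)$ colors such that each vertex has at most $\lfloor a/t\rfloor$ neighbors of its own color in its $H$-set.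 (iii) In one round, each edge between different $H$-sets is oriented towards the set of greater index, each edge inside an $H$-set whose endpoints have different colors is oriented towards the greater color, and the other edges stay unoriented. 2. *Simple-Arbdefective.* Each vertex waits until all its parents (the neighbors towards which its outgoing edges are oriented) have selected a color, then selects a color from $\{1,\dots,k\}$ that is used by the minimum number of its parents and sends its selection to its neighbors. **Statement.** Let $\varepsilon>0$. There are deterministic distributed subroutines for (i) and (ii), where (i) is correct on every $n$-vertex graph of arboricity at most $a$ and (ii) on every $n$-vertex graph of maximum degree at most $\lfloor(2+\varepsilon)a\rfloor$ (for all $n\ge 2$, $a\ge 0$ and $t\ge 1$, the constants in $O(\log n)$ and $O(t^2)$ depending only on $\varepsilon$), and there is a constant $C$ depending only on $\varepsilon$, such that with these subroutines the following holds for all integers $n\ge 2$, $a\ge 0$, $k\ge 1$, $t\ge 1$ and every $n$-vertex graph $G$ of arboricity at most $a$: Procedure Arbdefective-Coloring computes a $$\left\lfloor \frac{a}{t}+(2+\varepsilon)\cdot\frac{a}{k}\right\rfloor\text{-arbdefective } k\text{-coloring of } G$$ within at most $C\,t^2\log n$ rounds. -/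

import Mathlib

/-! ### Arboricity and arbdefective colorings -/

/-- `G` decomposes into `r` forests: its edge set is partitioned into the edge sets of `r`
acyclic graphs on the same vertex set. -/
def HasForestsDecomposition {V : Type*} (G : SimpleGraph V) (r : ℕ) : Prop :=
  ∃ F : Fin r → SimpleGraph V,
    (∀ i, (F i).IsAcyclic) ∧ (∀ i j, i ≠ j → Disjoint (F i) (F j)) ∧ (⨆ i, F i) = G

/-- The arboricity of a (finite) graph: the minimal number of edge-disjoint forests that cover
the edge set. -/
noncomputable def arboricity {V : Type*} (G : SimpleGraph V) : ℕ :=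
  sInf {r : ℕ | HasForestsDecomposition G r}

/-- An `r`-arbdefective `k`-coloring: the colors are `1, …, k`, and each color class induces a
subgraph of arboricity at most `r`. -/
def IsArbdefectiveColoring {V : Type*} (G : SimpleGraph V) (r k : ℕ) (φ : V → ℕ) : Prop :=
  (∀ v, φ v ∈ Finset.Icc 1 k) ∧
    ∀ i ∈ Finset.Icc 1 k, arboricity (G.induce {v | φ v = i}) ≤ r

/-- An `m`-defective `p`-coloring: the colors are `1, …, p`, and each vertex has at most `m`
neighbors of its own color. -/
def IsDefectiveColoring {V : Type*} (G : SimpleGraph V) (m p : ℕ) (φ : V → ℕ) : Prop :=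
  (∀ v, φ v ∈ Finset.Icc 1 p) ∧ ∀ v, {u | G.Adj v u ∧ φ u = φ v}.ncard ≤ m

/-- An H-partition `H₁, …, H_ℓ` of degree at most `d`, given by the map `h` that sends a vertex to
its H-index: each `v ∈ H_i` has at most `d` neighbors in `H_i ∪ … ∪ H_ℓ`. -/
def IsHPartition {V : Type*} (G : SimpleGraph V) (ℓ d : ℕ) (h : V → ℕ) : Prop :=
  (∀ v, h v ∈ Finset.Icc 1 ℓ) ∧ ∀ v, {u | G.Adj v u ∧ h v ≤ h u}.ncard ≤ d

/-! ### The synchronous message passing model -/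

/-- A deterministic distributed algorithm for `n`-vertex networks whose vertices carry the `n`
distinct identity numbers (here the elements of `Fin n`).
Initially a vertex knows its own identity number and its input, an element of `I`. In each round it
sends a message to all its neighbors, receives the messages that they sent in the same round, and
updates its state; local computation is free and messages are unbounded. (Since identity
numbers may be written into messages, sending one common message to all neighbors is no restriction
beyond one additional round.) A vertex may at some point fix its output, an element of `O`, and
it cannot revoke it; it goes on answering its neighbors. -/
structure LocalAlgorithm (n : ℕ) (I O : Type) where
  State : Type
  Msg : Type
  init : Fin n → I → State
  send : State → Msg
  receive : State → Multiset Msg → State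
  output : State → Option O
  output_irrevocable : ∀ s ms o, output s = some o → output (receive s ms) = some o

namespace LocalAlgorithm

variable {n : ℕ} {I M O : Type}

open Classical in
/-- The state of each vertex after a number of rounds, in the network `G` with the given inputs. -/
noncomputable def run (A : LocalAlgorithm n I O) (G : SimpleGraph (Fin n)) (input : Fin n → I) :
    ℕ → Fin n → A.State
  | 0, v => A.init v (input v)
  | r + 1, v => A.receive (A.run G input r v)
      ((G.neighborFinset v).val.map fun u => A.send (A.run G input r u))

/-- Within `r` rounds every vertex `v` of the network has fixed its output, and it is `out v`. -/
def ComputesIn (A : LocalAlgorithm n I O) (G : SimpleGraph (Fin n)) (input : Fin n → I)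
    (r : ℕ) (out : Fin n → O) : Prop :=
  ∀ v, A.output (A.run G input r v) = some (out v)

/-- Auxiliary to `seq`: the state after `j` rounds of `A`, when `A` has reached state `s`. -/
def seqEnter (A : LocalAlgorithm n I M) (T : ℕ) (B : LocalAlgorithm n M O) (v : Fin n)
    (j : ℕ) (s : A.State) : (ℕ × A.State) ⊕ B.State :=
  match A.output s with
  | some m => if T ≤ j then Sum.inr (B.init v m) else Sum.inl (j, s)
  | none => Sum.inl (j, s)

/-- Sequential composition: run `A` for `T` rounds, then start `B` with the output of `A` as
its input. -/
def seq (A : LocalAlgorithm n I M) (T : ℕ) (B : LocalAlgorithm n M O) : LocalAlgorithm n I O where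
  State := Fin n × ((ℕ × A.State) ⊕ B.State)
  Msg := A.Msg ⊕ B.Msg
  init v i := (v, seqEnter A T B v 0 (A.init v i))
  send
    | (_, Sum.inl (_, s)) => Sum.inl (A.send s)
    | (_, Sum.inr s) => Sum.inr (B.send s)
  receive
    | (v, Sum.inl (j, s)), ms =>
        (v, seqEnter A T B v (j + 1) (A.receive s (ms.filterMap Sum.getLeft?)))
    | (v, Sum.inr s), ms => (v, Sum.inr (B.receive s (ms.filterMap Sum.getRight?)))
  output
    | (_, Sum.inl _) => none
    | (_, Sum.inr s) => B.output s
  output_irrevocable := by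
    rintro ⟨v, ⟨j, s⟩ | s⟩ ms o h
    · simp at h
    · exact B.output_irrevocable s _ o h

/-- Every vertex receives the index of its class as input, and `B` is run in parallel on all the
subgraphs induced by the classes: messages are tagged with the index of the sender's class, and
those from other classes are ignored. The output is the index together with the output of `B`. -/
def inClasses (B : LocalAlgorithm n Unit O) : LocalAlgorithm n ℕ (ℕ × O) where
  State := ℕ × B.State
  Msg := ℕ × B.Msg
  init v h := (h, B.init v ())
  send s := (s.1, B.send s.2)
  receive s ms :=
    (s.1, B.receive s.2 (ms.filterMap fun m => if m.1 = s.1 then some m.2 else none))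
  output s := (B.output s.2).map fun o => (s.1, o)
  output_irrevocable := by
    rintro ⟨h, s⟩ ms o ho
    obtain ⟨c, hc, rfl⟩ := Option.map_eq_some_iff.mp ho
    exact Option.map_eq_some_iff.mpr ⟨c, B.output_irrevocable s _ c hc, rfl⟩

end LocalAlgorithm

/-- A distributed algorithm without inputs (apart from the identity numbers) together with the
number of rounds for which it is run when it is used as a subroutine. -/
structure Subroutine (n : ℕ) (O : Type) where
  alg : LocalAlgorithm n Unit O
  rounds : ℕ

/-- In the network `G` the subroutine computes `out` within its number of rounds. -/
def Subroutine.Computes {n : ℕ} {O : Type} (S : Subroutine n O) (G : SimpleGraph (Fin n))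
    (out : Fin n → O) : Prop :=
  S.alg.ComputesIn G (fun _ => ()) S.rounds out

/-! ### Procedure Partial-Orientation -/

/-- The orientation step. The input of a vertex is its H-index and its color in the defective
coloring of its H-set. In one round the vertices exchange these. An edge between different H-sets
is oriented towards the greater H-index, an edge inside an H-set towards the greater color, and
an edge inside an H-set whose endpoints have the same color stays unoriented. The output of a
vertex is the set of its parents, i.e. of the neighbors towards which it has an outgoing edge. -/
def orientEdges (n : ℕ) : LocalAlgorithm n (ℕ × ℕ) (Finset (Fin n)) where
  State := Fin n × (ℕ × ℕ) × Option (Finset (Fin n))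
  Msg := Fin n × (ℕ × ℕ)
  init v x := (v, x, none)
  send s := (s.1, s.2.1)
  receive
    | (v, x, none), ms =>
        (v, x, some ((ms.filter fun m => x.1 < m.2.1 ∨ (x.1 = m.2.1 ∧ x.2 < m.2.2)).map
          Prod.fst).toFinset)
    | (v, x, some P), _ => (v, x, some P)
  output s := s.2.2
  output_irrevocable := by
    rintro ⟨v, x, _ | P⟩ ms o h
    · simp at h
    · exact h

/-- Procedure Partial-Orientation: compute an H-partition, compute in parallel a defective coloring
of each of the subgraphs induced by the H-sets, then orient the edges. -/
def partialOrientation {n : ℕ} (hPart defCol : Subroutine n ℕ) :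
    LocalAlgorithm n Unit (Finset (Fin n)) :=
  (hPart.alg.seq hPart.rounds defCol.alg.inClasses).seq (hPart.rounds + defCol.rounds)
    (orientEdges n)

/-! ### Procedure Simple-Arbdefective and Procedure Arbdefective-Coloring -/

/-- A color of the range `1, …, k` that occurs least often in the multiset `used` (the smallest
such color). -/
noncomputable def leastUsed (k : ℕ) (used : Multiset ℕ) : ℕ :=
  sInf {c : ℕ | c ∈ Finset.Icc 1 k ∧ ∀ d ∈ Finset.Icc 1 k, used.count c ≤ used.count d}

open Classical in
/-- The decision of a vertex with the given set of parents, when the messages in `ms` (identity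
number and selection, if any, of each sender) have arrived: if all parents have selected a color,
select a color that is used by the minimum number of parents. -/
noncomputable def selectColor {n : ℕ} (k : ℕ) (parents : Finset (Fin n))
    (ms : Multiset (Fin n × Option ℕ)) : Option ℕ :=
  if ∀ p ∈ parents, ∃ c, (p, some c) ∈ ms then
    some (leastUsed k (ms.filterMap fun m => if m.1 ∈ parents then m.2 else none))
  else none

/-- Procedure Simple-Arbdefective. The input of a vertex is the set of its parents. A vertex waits
for all its parents to select their colors, then selects a color from `1, …, k` that is used by
the minimum number of its parents, and sends its selection to all neighbors. -/
noncomputable def simpleArbdefective (n k : ℕ) : LocalAlgorithm n (Finset (Fin n)) ℕ where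
  State := Fin n × Finset (Fin n) × Option ℕ
  Msg := Fin n × Option ℕ
  init v parents := (v, parents, selectColor k parents 0)
  send s := (s.1, s.2.2)
  receive
    | (v, parents, none), ms => (v, parents, selectColor k parents ms)
    | (v, parents, some c), _ => (v, parents, some c)
  output s := s.2.2
  output_irrevocable := by
    rintro ⟨v, parents, _ | c⟩ ms o h
    · simp at h
    · exact h

/-- Procedure Arbdefective-Coloring: run Procedure Partial-Orientation, which takes one round more
than its two subroutines, then Procedure Simple-Arbdefective on the computed orientation. -/
noncomputable def arbdefectiveColoring {n : ℕ} (hPart defCol : Subroutine n ℕ) (k : ℕ) :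
    LocalAlgorithm n Unit ℕ :=
  (partialOrientation hPart defCol).seq (hPart.rounds + defCol.rounds + 1)
    (simpleArbdefective n k)

/-! ### What the two subroutines of Procedure Partial-Orientation have to compute -/

/-- On every `n`-vertex graph of arboricity at most `a` the subroutine computes an H-partition into
at most `c * log n` sets, of degree at most `⌊(2 + ε) a⌋`. -/
def ComputesHPartition (ε c : ℝ) (n a : ℕ) (S : Subroutine n ℕ) : Prop :=
  ∀ G : SimpleGraph (Fin n), arboricity G ≤ a →
    ∃ (ℓ : ℕ) (h : Fin n → ℕ), (ℓ : ℝ) ≤ c * Real.logb 2 n ∧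
      IsHPartition G ℓ ⌊(2 + ε) * a⌋₊ h ∧ S.Computes G h

/-- On every `n`-vertex graph of maximum degree at most `⌊(2 + ε) a⌋` the subroutine computes an
`⌊a / t⌋`-defective coloring with at most `c * t ^ 2` colors. -/
def ComputesDefectiveColoring (ε c : ℝ) (n a t : ℕ) (S : Subroutine n ℕ) : Prop :=
  ∀ G : SimpleGraph (Fin n), (∀ v, (G.neighborSet v).ncard ≤ ⌊(2 + ε) * a⌋₊) →
    ∃ (p : ℕ) (ψ : Fin n → ℕ), (p : ℝ) ≤ c * (t : ℝ) ^ 2 ∧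
      IsDefectiveColoring G (a / t) p ψ ∧ S.Computes G ψ

/-! Correctness rests on one principle: if the vertices are linearly ordered and each has at most
`r` greater neighbors, the graph splits into `r` forests (`hasForestsDecomposition_of_linearOrder`).
Rank vertices by H-index, then defective color, then identity number. Inside a color class, a
greater neighbor is either a parent of the same color or agrees in H-index and defective color.
There are at most `⌊d / k⌋` of the former, with `d = ⌊(2 + ε) a⌋`, because a least used color occurs
at most average often among at most `d` parents; there are at most `⌊a / t⌋` of the latter
(`arboricity_induce_le`).

For the time, with `ℓ` H-sets and `p` defective colors, the potential `(h v - 1) * p + ψ v`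
increases along every oriented edge and is at most `ℓ * p`. So no vertex waits longer than `ℓ * p =
O(t² log n)` rounds (`selection_isSome`).

The H-partition comes from peeling. A union of `a` forests has average degree at most `2 a` on every
vertex subset, so removing the vertices of degree at most `d` shrinks the rest by a factor `1 + ε /
2` (`peel_eq_empty`). For the defective coloring, colors are read as quadratic polynomials over a
field of size `2 ^ m`, and each vertex moves to a point of its graph with few conflicts. As `m`
decreases by one per round, the defects form a geometric sum (`run_iteratedRecoloring`); the
resulting `O(log n)` rounds fit the time bound. -/

open Finset

/-! ### Forests and arboricity -/

namespace SimpleGraph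

/-- The least vertex of a cycle would have two distinct greater neighbors, namely its two neighbors
on the cycle. -/
theorem isAcyclic_of_subsingleton_gt_neighbors {V : Type*} [LinearOrder V] {G : SimpleGraph V}
    (h : ∀ v u w, G.Adj v u → G.Adj v w → v < u → v < w → u = w) : G.IsAcyclic := by
  intro v c hc
  obtain ⟨m, hm, hmin⟩ := c.support.toFinset.exists_min_image id ⟨v, by simp⟩
  simp only [List.mem_toFinset, id] at hm hmin
  have hr := hc.rotate hm
  have hmem : ∀ x ∈ (c.rotate m hm).support, m ≤ x := fun x hx => hmin x (by
    simpa using hx)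
  have a1 := (c.rotate m hm).adj_snd hr.not_nil
  have a2 := ((c.rotate m hm).adj_penultimate hr.not_nil).symm
  exact hr.snd_ne_penultimate (h m _ _ a1 a2
    (lt_of_le_of_ne (hmem _ (Walk.getVert_mem_support _ _)) a1.ne)
    (lt_of_le_of_ne (hmem _ (Walk.getVert_mem_support _ _)) a2.ne))

theorem IsAcyclic.card_edgeFinset_le {V : Type*} [Fintype V] {G : SimpleGraph V}
    [Fintype G.edgeSet] (h : G.IsAcyclic) : #G.edgeFinset ≤ Fintype.card V := by
  classical
  cases isEmpty_or_nonempty V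
  · have : G = ⊥ := Subsingleton.elim _ _
    subst this
    simp
  · obtain ⟨T, hT, -, hTree⟩ :=
      (connected_top (V := V)).exists_isTree_le_of_le_of_isAcyclic le_top h
    have := hTree.card_edgeFinset
    have := card_le_card (edgeFinset_mono hT)
    omega

end SimpleGraph

/-- A graph whose edges can be oriented along a linear order with out-degrees at most `d`
decomposes into `d` forests. -/
theorem hasForestsDecomposition_of_linearOrder {V : Type*} [Finite V] [LinearOrder V]
    (G : SimpleGraph V) (d : ℕ) (h : ∀ v, {u | G.Adj v u ∧ v < u}.ncard ≤ d) :
    HasForestsDecomposition G d := by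
  classical
  -- Each vertex numbers its greater neighbors injectively by labels below `d`; the default label 0
  -- is never used.
  have hlab : ∀ v, ∃ g : V → ℕ, Set.InjOn g {u | G.Adj v u ∧ v < u} ∧
      ∀ u, G.Adj v u → v < u → g u < d := by
    intro v
    let e := Finite.equivFin {u | G.Adj v u ∧ v < u}
    refine ⟨fun u => if hu : G.Adj v u ∧ v < u then (e ⟨u, hu⟩ : ℕ) else 0, ?_, ?_⟩
    · intro x hx y hy hxy
      simp only [dif_pos (show G.Adj v x ∧ v < x from hx),
        dif_pos (show G.Adj v y ∧ v < y from hy)] at hxy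
      simpa using e.injective (Fin.ext hxy)
    · intro u hu hvu
      simp only [dif_pos (⟨hu, hvu⟩ : G.Adj v u ∧ v < u)]
      exact lt_of_lt_of_le (e ⟨u, hu, hvu⟩).2 (h v)
  choose g hinj hlt using hlab
  -- An edge goes to the forest named by the label that its smaller endpoint gives to the greater
  -- one.
  let F : Fin d → SimpleGraph V := fun i =>
    { Adj := fun x y => G.Adj x y ∧ g (min x y) (max x y) = i
      symm := ⟨fun x y hxy => ⟨hxy.1.symm, by rw [min_comm, max_comm]; exact hxy.2⟩⟩
      loopless := ⟨fun x hx => G.loopless.irrefl x hx.1⟩ }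
  refine ⟨F, fun i => ?_, fun i j hij => ?_, ?_⟩
  · refine SimpleGraph.isAcyclic_of_subsingleton_gt_neighbors fun v u w hu hw hvu hvw => ?_
    refine hinj v ⟨hu.1, hvu⟩ ⟨hw.1, hvw⟩ ?_
    have h1 := hu.2
    have h2 := hw.2
    rw [min_eq_left hvu.le, max_eq_right hvu.le] at h1
    rw [min_eq_left hvw.le, max_eq_right hvw.le] at h2
    rw [h1, h2]
  · rw [disjoint_iff_inf_le]
    intro x y hxy
    exact hij (Fin.ext (hxy.1.2.symm.trans hxy.2.2))
  · ext x y
    rw [SimpleGraph.iSup_adj]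
    refine ⟨fun ⟨i, hi⟩ => hi.1, fun hxy => ?_⟩
    have : g (min x y) (max x y) < d := by
      rcases lt_or_gt_of_ne hxy.ne with hl | hl
      · rw [min_eq_left hl.le, max_eq_right hl.le]; exact hlt x y hxy hl
      · rw [min_eq_right hl.le, max_eq_left hl.le]; exact hlt y x hxy.symm hl
    exact ⟨⟨_, this⟩, hxy, rfl⟩

/-- If the vertices have distinct ranks and every vertex has at most `d` neighbors of greater rank,
then the arboricity is at most `d`. -/
theorem arboricity_le_of_injective {V L : Type*} [Finite V] [LinearOrder L]
    (G : SimpleGraph V) (d : ℕ) (ρ : V → L) (hρ : Function.Injective ρ)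
    (h : ∀ v, {u | G.Adj v u ∧ ρ v < ρ u}.ncard ≤ d) : arboricity G ≤ d :=
  letI := LinearOrder.lift' ρ hρ
  Nat.sInf_le (hasForestsDecomposition_of_linearOrder G d h)

/-- A finite graph decomposes into as many forests as its arboricity says. -/
theorem hasForestsDecomposition_arboricity {V : Type*} [Finite V] [LinearOrder V]
    (G : SimpleGraph V) : HasForestsDecomposition G (arboricity G) :=
  Nat.sInf_mem (s := {r | HasForestsDecomposition G r})
    -- Some decomposition must exist, since the infimum of the empty set would be 0.
    ⟨Nat.card V, hasForestsDecomposition_of_linearOrder G _ fun _ =>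
      Set.ncard_le_card _⟩

/-- The sum of the degrees in an induced subgraph of a graph of arboricity `r` is at most `2 r`
times the number of its vertices. -/
theorem HasForestsDecomposition.sum_card_neighbors_le {V : Type*} [Fintype V] [DecidableEq V]
    {G : SimpleGraph V} [DecidableRel G.Adj] {r : ℕ} (h : HasForestsDecomposition G r)
    (U : Finset V) : ∑ v ∈ U, #{u ∈ U | G.Adj v u} ≤ 2 * r * #U := by
  classical
  obtain ⟨F, hF, -, rfl⟩ := h
  -- Each forest restricted to `U` is a forest, hence has at most `#U` edges.
  have hi : ∀ i, ∑ v ∈ U, #{u ∈ U | (F i).Adj v u} ≤ 2 * #U := by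
    intro i
    have h1 := ((hF i).induce (U : Set V)).card_edgeFinset_le
    have h2 := ((F i).induce (U : Set V)).sum_degrees_eq_twice_card_edges
    have h3 : ∑ v ∈ U, #{u ∈ U | (F i).Adj v u} =
        ∑ v : (U : Set V), ((F i).induce (U : Set V)).degree v := by
      rw [← Finset.sum_coe_sort U]
      refine Finset.sum_congr rfl fun v _ => ?_
      rw [← SimpleGraph.card_neighborFinset_eq_degree]
      refine (Finset.card_bij (fun u _ => u.1) ?_ ?_ ?_).symm
      · intro u hu
        simpa using hu
      · intro x _ y _ hxy
        exact Subtype.ext hxy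
      · intro u hu
        simp only [mem_filter] at hu
        exact ⟨⟨u, hu.1⟩, by simpa using hu.2, rfl⟩
    have h4 : Fintype.card (U : Set V) = #U := by simp
    omega
  calc ∑ v ∈ U, #{u ∈ U | (⨆ i, F i).Adj v u}
      ≤ ∑ v ∈ U, ∑ i, #{u ∈ U | (F i).Adj v u} := by
        refine Finset.sum_le_sum fun v _ => ?_
        refine (Finset.card_le_card ?_).trans
          (Finset.card_biUnion_le (s := univ) (t := fun i => {u ∈ U | (F i).Adj v u}))
        intro u hu
        simpa [SimpleGraph.iSup_adj] using hu
    _ = ∑ i, ∑ v ∈ U, #{u ∈ U | (F i).Adj v u} := Finset.sum_comm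
    _ ≤ ∑ _i : Fin r, 2 * #U := Finset.sum_le_sum fun i _ => hi i
    _ = 2 * r * #U := by simp; ring

/-! ### Composition of distributed algorithms -/

theorem Multiset.filterMap_ite_some {α β : Type*} (p : α → Prop) [DecidablePred p] (f : α → β)
    (s : Multiset α) :
    s.filterMap (fun a => if p a then some (f a) else none) = (s.filter p).map f := by
  induction s using Multiset.induction_on with
  | empty => rfl
  | cons a s ih =>
    by_cases ha : p a
    · rw [Multiset.filterMap_cons_some _ _ _ (b := f a) (by simp [ha]), ih,
        Multiset.filter_cons_of_pos s ha, Multiset.map_cons]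
    · rw [Multiset.filterMap_cons_none _ _ (by simp [ha]), ih, Multiset.filter_cons_of_neg s ha]

namespace LocalAlgorithm

variable {n : ℕ} {I M O : Type}

theorem filterMap_getLeft?_map_inl {α β γ : Type*} (s : Multiset γ) (f : γ → α) :
    (s.map fun u => (Sum.inl (f u) : α ⊕ β)).filterMap Sum.getLeft? = s.map f := by
  rw [Multiset.filterMap_map]
  exact Multiset.filterMap_eq_map _ ▸ rfl

theorem filterMap_getRight?_map_inr {α β γ : Type*} (s : Multiset γ) (f : γ → β) :
    (s.map fun u => (Sum.inr (f u) : α ⊕ β)).filterMap Sum.getRight? = s.map f := by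
  rw [Multiset.filterMap_map]
  exact Multiset.filterMap_eq_map _ ▸ rfl

theorem seqEnter_of_lt (A : LocalAlgorithm n I M) (T : ℕ) (B : LocalAlgorithm n M O) (v : Fin n)
    {j : ℕ} (hj : j < T) (s : A.State) : seqEnter A T B v j s = Sum.inl (j, s) := by
  unfold seqEnter
  cases A.output s with
  | none => rfl
  | some m => exact if_neg (by omega)

/-- All round counters agree, so before time `T` every message comes from `A` and the filter
discards none. -/
theorem run_seq_of_le (A : LocalAlgorithm n I M) (T : ℕ) (B : LocalAlgorithm n M O)
    (G : SimpleGraph (Fin n)) (input : Fin n → I) (r : ℕ) (hr : r ≤ T) (v : Fin n) :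
    (A.seq T B).run G input r v = (v, seqEnter A T B v r (A.run G input r v)) := by
  classical
  induction r generalizing v with
  | zero => rfl
  | succ r ih =>
    have ih' : ∀ u, (A.seq T B).run G input r u = (u, Sum.inl (r, A.run G input r u)) := fun u => by
      rw [ih (by omega), seqEnter_of_lt _ _ _ _ (by omega)]
    simp only [run, ih']
    simp only [seq, filterMap_getLeft?_map_inl]

/-- All outputs of `A` are fixed by time `T` and early finishers wait, so all vertices enter `B`
simultaneously. -/
theorem run_seq_add {A : LocalAlgorithm n I M} {T : ℕ} (B : LocalAlgorithm n M O)
    {G : SimpleGraph (Fin n)} {input : Fin n → I} {m : Fin n → M}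
    (hA : A.ComputesIn G input T m) (r : ℕ) (v : Fin n) :
    (A.seq T B).run G input (T + r) v = (v, Sum.inr (B.run G m r v)) := by
  classical
  induction r generalizing v with
  | zero =>
    rw [Nat.add_zero, run_seq_of_le _ _ _ _ _ _ le_rfl]
    simp only [seqEnter, hA v, le_refl, if_true]
    rfl
  | succ r ih =>
    rw [← Nat.add_assoc]
    simp only [run, ih]
    simp only [seq, filterMap_getRight?_map_inr]

theorem ComputesIn.seq {A : LocalAlgorithm n I M} {T : ℕ} {B : LocalAlgorithm n M O}
    {G : SimpleGraph (Fin n)} {input : Fin n → I} {m : Fin n → M} {r : ℕ} {out : Fin n → O}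
    (hA : A.ComputesIn G input T m) (hB : B.ComputesIn G m r out) :
    (A.seq T B).ComputesIn G input (T + r) out := fun v => by
  rw [run_seq_add B hA]
  exact hB v

theorem output_run_mono (A : LocalAlgorithm n I O) (G : SimpleGraph (Fin n)) (input : Fin n → I)
    {r r' : ℕ} (hr : r ≤ r') {v : Fin n} {o : O} (h : A.output (A.run G input r v) = some o) :
    A.output (A.run G input r' v) = some o := by
  induction hr with
  | refl => exact h
  | step _ ih => exact A.output_irrevocable _ _ _ ih

end LocalAlgorithm

/-- The edges of `G` inside the classes given by `h`. -/
def SimpleGraph.withinClasses {V : Type*} (G : SimpleGraph V) (h : V → ℕ) : SimpleGraph V where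
  Adj u v := G.Adj u v ∧ h u = h v
  symm := ⟨fun _ _ H => ⟨H.1.symm, H.2.symm⟩⟩
  loopless := ⟨fun _ H => G.loopless.irrefl _ H.1⟩

namespace LocalAlgorithm

variable {n : ℕ} {O : Type}

/-- The parallel runs on the classes amount to a single run on the union of the induced subgraphs,
which is again an `n`-vertex graph; a subroutine for such graphs therefore applies once. -/
theorem run_inClasses (B : LocalAlgorithm n Unit O) (G : SimpleGraph (Fin n)) (h : Fin n → ℕ)
    (r : ℕ) (v : Fin n) :
    B.inClasses.run G h r v = (h v, B.run (G.withinClasses h) (fun _ => ()) r v) := by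
  classical
  induction r generalizing v with
  | zero => rfl
  | succ r ih =>
    simp only [run, ih]
    simp only [inClasses]
    congr 2
    rw [Multiset.filterMap_map]
    have e : ∀ g : Fin n → B.Msg, Multiset.filterMap
        ((fun m : ℕ × B.Msg => if m.1 = h v then some m.2 else none) ∘ fun u => (h u, g u))
        (G.neighborFinset v).val =
        ((G.withinClasses h).neighborFinset v).val.map g := by
      intro g
      have h1 : (G.withinClasses h).neighborFinset v =
          (G.neighborFinset v).filter fun u => h u = h v := by
        ext u
        rw [SimpleGraph.mem_neighborFinset, Finset.mem_filter, SimpleGraph.mem_neighborFinset]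
        exact and_congr_right fun _ => eq_comm
      rw [h1, Finset.filter_val, ← Multiset.filterMap_ite_some]
      rfl
    exact e _

theorem ComputesIn.inClasses {B : LocalAlgorithm n Unit O} {G : SimpleGraph (Fin n)}
    {h : Fin n → ℕ} {r : ℕ} {out : Fin n → O}
    (hB : B.ComputesIn (G.withinClasses h) (fun _ => ()) r out) :
    B.inClasses.ComputesIn G h r fun v => (h v, out v) := fun v => by
  rw [run_inClasses]
  exact Option.map_eq_some_iff.mpr ⟨_, hB v, rfl⟩

end LocalAlgorithm

/-! ### The orientation step -/

open Classical in
/-- The parents of `v` when the edges are oriented towards the lexicographically greater pair. -/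
noncomputable def lexParents {V : Type*} [Fintype V] (G : SimpleGraph V) (x : V → ℕ × ℕ) (v : V) :
    Finset V :=
  {u | G.Adj v u ∧ ((x v).1 < (x u).1 ∨ ((x v).1 = (x u).1 ∧ (x v).2 < (x u).2))}

theorem orientEdges_computesIn {n : ℕ} (G : SimpleGraph (Fin n)) (x : Fin n → ℕ × ℕ) :
    (orientEdges n).ComputesIn G x 1 (lexParents G x) := fun v => by
  classical
  simp only [LocalAlgorithm.run, orientEdges]
  congr 1
  ext u
  simp only [lexParents, Multiset.mem_toFinset, Multiset.mem_map, Multiset.mem_filter,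
    Finset.mem_filter, Finset.mem_univ, true_and]
  constructor
  · rintro ⟨_, ⟨⟨w, hw, rfl⟩, h⟩, rfl⟩
    exact ⟨by simpa using hw, h⟩
  · rintro ⟨h1, h2⟩
    exact ⟨_, ⟨⟨u, by simpa using h1, rfl⟩, h2⟩, rfl⟩

theorem partialOrientation_computesIn {n : ℕ} {hPart defCol : Subroutine n ℕ}
    {G : SimpleGraph (Fin n)} {h ψ : Fin n → ℕ} (hh : hPart.Computes G h)
    (hψ : defCol.Computes (G.withinClasses h) ψ) :
    (partialOrientation hPart defCol).ComputesIn G (fun _ => ())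
      (hPart.rounds + defCol.rounds + 1) (lexParents G fun v => (h v, ψ v)) :=
  (LocalAlgorithm.ComputesIn.seq hh hψ.inClasses).seq (orientEdges_computesIn G _)

/-! ### H-partition by peeling -/

section Peeling

variable {V : Type*} [Fintype V]

open Classical in
/-- What is left of the vertex set after `r` rounds, when in each round all vertices that have at
most `d` remaining neighbors are removed. -/
noncomputable def peel (G : SimpleGraph V) (d : ℕ) : ℕ → Finset V
  | 0 => univ
  | r + 1 => {v ∈ peel G d r | d < #{u ∈ peel G d r | G.Adj v u}}

theorem peel_antitone (G : SimpleGraph V) (d : ℕ) : Antitone (peel G d) :=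
  antitone_nat_of_succ_le fun _ => Finset.filter_subset _ _

/-- The round in which a vertex is removed. -/
noncomputable def peelIndex (G : SimpleGraph V) (d : ℕ) (v : V) : ℕ :=
  sInf {r | v ∉ peel G d r}

variable {G : SimpleGraph V} {d ℓ : ℕ}

/-- The remaining sets decrease, so each vertex survives an initial segment of rounds; `hℓ` ensures
that the infimum is attained. -/
theorem mem_peel_iff (hℓ : peel G d ℓ = ∅) (v : V) (r : ℕ) :
    v ∈ peel G d r ↔ r < peelIndex G d v := by
  have hne : {r | v ∉ peel G d r}.Nonempty := ⟨ℓ, by simp [hℓ]⟩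
  constructor
  · intro h
    by_contra! hc
    exact Nat.sInf_mem hne (peel_antitone G d hc h)
  · intro h
    by_contra hc
    exact Nat.notMem_of_lt_sInf h hc

/-- The vertices of index at least `r + 1` are exactly those left after `r` rounds, and a vertex of
index `r + 1` has at most `d` neighbors among them. -/
theorem isHPartition_peelIndex (hℓ : peel G d ℓ = ∅) : IsHPartition G ℓ d (peelIndex G d) := by
  classical
  have hpos : ∀ v, 0 < peelIndex G d v := fun v =>
    (mem_peel_iff hℓ v 0).1 (by simp [peel])
  refine ⟨fun v => ?_, fun v => ?_⟩
  · rw [Finset.mem_Icc]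
    refine ⟨hpos v, ?_⟩
    by_contra! h
    have := (mem_peel_iff hℓ v ℓ).2 h
    simp [hℓ] at this
  · obtain ⟨r, hr⟩ : ∃ r, peelIndex G d v = r + 1 := ⟨_, (Nat.succ_pred_eq_of_pos (hpos v)).symm⟩
    have h1 : v ∈ peel G d r := (mem_peel_iff hℓ v r).2 (by omega)
    have h2 : v ∉ peel G d (r + 1) := fun h => by
      have := (mem_peel_iff hℓ v (r + 1)).1 h
      omega
    simp only [peel, Finset.mem_filter, not_and, not_lt] at h2
    refine le_trans (le_of_eq ?_) (h2 h1)
    rw [← Set.ncard_coe_finset]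
    congr 1
    ext u
    simp only [Set.mem_ofPred_eq, Finset.coe_filter, mem_peel_iff hℓ, hr, Nat.succ_le_iff]
    exact and_comm

/-- Double counting: each survivor contributes at least `d + 1` to a degree sum bounded through the
forests. -/
theorem card_peel_succ_le {a : ℕ} (h : HasForestsDecomposition G a) (r : ℕ) :
    (d + 1) * #(peel G d (r + 1)) ≤ 2 * a * #(peel G d r) := by
  classical
  refine le_trans ?_ (h.sum_card_neighbors_le (peel G d r))
  calc (d + 1) * #(peel G d (r + 1)) = ∑ _v ∈ peel G d (r + 1), (d + 1) := by
        rw [Finset.sum_const, smul_eq_mul, mul_comm]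
    _ ≤ ∑ v ∈ peel G d (r + 1), #{u ∈ peel G d r | G.Adj v u} := by
        refine Finset.sum_le_sum fun v hv => ?_
        simp only [peel, Finset.mem_filter] at hv
        exact hv.2
    _ ≤ _ := Finset.sum_le_sum_of_subset (Finset.filter_subset _ _)

theorem peel_eq_empty {a : ℕ} {ε : ℝ} (hε : 0 < ε) (h : HasForestsDecomposition G a)
    (hℓ : (Fintype.card V : ℝ) < (1 + ε / 2) ^ ℓ) : peel G ⌊(2 + ε) * a⌋₊ ℓ = ∅ := by
  set d := ⌊(2 + ε) * a⌋₊ with hd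
  have hstep : ∀ r, (1 + ε / 2) * #(peel G d (r + 1)) ≤ #(peel G d r) := by
    intro r
    have h1 : ((d : ℝ) + 1) * #(peel G d (r + 1)) ≤ 2 * a * #(peel G d r) := by
      exact_mod_cast card_peel_succ_le (d := d) h r
    have h2 : (2 + ε) * a < d + 1 := Nat.lt_floor_add_one _
    have hX : (0 : ℝ) ≤ #(peel G d (r + 1)) := Nat.cast_nonneg _
    -- The factor `2 * a` can be cancelled only for positive `a`; for `a = 0` nothing survives a
    -- round.
    rcases Nat.eq_zero_or_pos a with rfl | ha
    · have : (#(peel G d (r + 1)) : ℝ) = 0 := by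
        have hd0 : (0 : ℝ) ≤ d := Nat.cast_nonneg _
        simp only [Nat.cast_zero, mul_zero, zero_mul] at h1
        nlinarith
      rw [this]
      simp
    · have ha' : (0 : ℝ) < a := Nat.cast_pos.2 ha
      have h3 := mul_le_mul_of_nonneg_right h2.le hX
      have h4 : (2 * a : ℝ) * ((1 + ε / 2) * #(peel G d (r + 1))) ≤ 2 * a * #(peel G d r) := by
        linarith
      exact le_of_mul_le_mul_left h4 (by positivity)
  have hpow : ∀ r, (1 + ε / 2) ^ r * #(peel G d r) ≤ Fintype.card V := by
    intro r
    induction r with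
    | zero => simp [peel]
    | succ r ih =>
      refine le_trans ?_ ih
      rw [pow_succ, mul_assoc]
      exact mul_le_mul_of_nonneg_left (hstep r) (by positivity)
  by_contra hne
  have h1 : (1 : ℝ) ≤ #(peel G d ℓ) := by
    exact_mod_cast Finset.card_pos.2 (Finset.nonempty_iff_ne_empty.2 hne)
  have h2 := hpow ℓ
  have h3 : (0 : ℝ) < (1 + ε / 2) ^ ℓ := by positivity
  nlinarith

end Peeling

/-- The peeling process as a distributed algorithm: a vertex outputs the number of the round in
which it has at most `d` remaining neighbors for the first time. -/
def peelingAlgorithm (n d : ℕ) : LocalAlgorithm n Unit ℕ where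
  State := ℕ × Option ℕ
  Msg := Bool
  init _ _ := (0, none)
  send s := s.2.isNone
  receive
    | (j, none), ms => (j + 1, if ms.count true ≤ d then some (j + 1) else none)
    | (j, some i), _ => (j + 1, some i)
  output s := s.2
  output_irrevocable := by
    rintro ⟨j, _ | i⟩ ms o h
    · simp at h
    · exact h

theorem run_peelingAlgorithm {n d ℓ : ℕ} {G : SimpleGraph (Fin n)} (hℓ : peel G d ℓ = ∅) (r : ℕ)
    (v : Fin n) : (peelingAlgorithm n d).run G (fun _ => ()) r v =
      (r, if r < peelIndex G d v then none else some (peelIndex G d v)) := by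
  classical
  induction r generalizing v with
  | zero =>
    have : 0 < peelIndex G d v := (mem_peel_iff hℓ v 0).1 (by simp [peel])
    simp [LocalAlgorithm.run, peelingAlgorithm, this]
  | succ r ih =>
    simp only [LocalAlgorithm.run, ih]
    by_cases hr : r < peelIndex G d v
    -- The message `true` means "still undecided", so counting it gives the degree into the
    -- remaining set.
    · have hcount : Multiset.count true ((G.neighborFinset v).val.map fun u =>
          (if r < peelIndex G d u then none else some (peelIndex G d u) : Option ℕ).isNone) =
          #{u ∈ peel G d r | G.Adj v u} := by
        rw [Multiset.count_map, ← Finset.filter_val, Finset.card_val]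
        congr 1
        ext u
        simp only [Finset.mem_filter, SimpleGraph.mem_neighborFinset, mem_peel_iff hℓ]
        by_cases hu : r < peelIndex G d u <;> simp [hu]
      have hmem : v ∈ peel G d (r + 1) ↔ d < #{u ∈ peel G d r | G.Adj v u} := by
        simp only [peel, Finset.mem_filter, (mem_peel_iff hℓ v r).2 hr, true_and]
      rw [mem_peel_iff hℓ] at hmem
      simp only [peelingAlgorithm, if_pos hr, hcount]
      by_cases h : r + 1 < peelIndex G d v
      · rw [if_pos h, if_neg (by have := hmem.1 h; omega)]
      · rw [if_neg h, if_pos (by rw [hmem] at h; omega),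
          show peelIndex G d v = r + 1 by omega]
    · simp only [if_neg hr, if_neg (show ¬ r + 1 < peelIndex G d v by omega), peelingAlgorithm]

theorem peelingAlgorithm_computesIn {n d ℓ : ℕ} {G : SimpleGraph (Fin n)}
    (hℓ : peel G d ℓ = ∅) :
    (peelingAlgorithm n d).ComputesIn G (fun _ => ()) ℓ (peelIndex G d) := fun v => by
  have h : ¬ ℓ < peelIndex G d v := fun h => by
    have := (mem_peel_iff hℓ v ℓ).2 h
    simp [hℓ] at this
  rw [run_peelingAlgorithm hℓ, if_neg h]
  rfl

/-- Serves to absorb additive constants into multiples of `log n`. -/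
theorem one_le_logb_two {n : ℕ} (hn : 2 ≤ n) : 1 ≤ Real.logb 2 n := by
  rw [Real.le_logb_iff_rpow_le (by norm_num) (by positivity)]
  simpa using (Nat.cast_le (α := ℝ)).2 hn

/-- The number of peeling rounds. -/
noncomputable def peelingRounds (ε : ℝ) (n : ℕ) : ℕ := ⌊Real.logb (1 + ε / 2) n⌋₊ + 1

theorem lt_pow_peelingRounds {ε : ℝ} (hε : 0 < ε) {n : ℕ} (hn : 2 ≤ n) :
    (n : ℝ) < (1 + ε / 2) ^ peelingRounds ε n := by
  have hb : 1 < 1 + ε / 2 := by linarith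
  have h := Nat.lt_floor_add_one (Real.logb (1 + ε / 2) n)
  rw [Real.logb_lt_iff_lt_rpow hb (by positivity)] at h
  rw [← Real.rpow_natCast]
  simpa [peelingRounds] using h

theorem peelingRounds_le {ε : ℝ} (hε : 0 < ε) {n : ℕ} (hn : 2 ≤ n) :
    (peelingRounds ε n : ℝ) ≤ (Real.log 2 / Real.log (1 + ε / 2) + 1) * Real.logb 2 n := by
  have hb : 1 < 1 + ε / 2 := by linarith
  have hlb : 0 < Real.log (1 + ε / 2) := Real.log_pos hb
  have hl2 : 0 < Real.log 2 := Real.log_pos (by norm_num)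
  have hln : 0 ≤ Real.log n := Real.log_nonneg (by exact_mod_cast (by omega : 1 ≤ n))
  have h1 := one_le_logb_two hn
  have h2 : (⌊Real.logb (1 + ε / 2) n⌋₊ : ℝ) ≤ Real.logb (1 + ε / 2) n :=
    Nat.floor_le (div_nonneg hln hlb.le)
  have h3 : Real.logb (1 + ε / 2) n =
      Real.log 2 / Real.log (1 + ε / 2) * Real.logb 2 n := by
    unfold Real.logb
    field_simp
  rw [add_mul, ← h3]
  push_cast [peelingRounds]
  linarith

/-- The subroutine that computes an H-partition. -/
noncomputable def peelingSubroutine (ε : ℝ) (n a : ℕ) : Subroutine n ℕ :=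
  ⟨peelingAlgorithm n ⌊(2 + ε) * a⌋₊, peelingRounds ε n⟩

/-- Padding with edgeless forests gives exactly `a` forests for arboricity at most `a`. -/
theorem HasForestsDecomposition.mono {V : Type*} {G : SimpleGraph V} {r s : ℕ} (hrs : r ≤ s)
    (h : HasForestsDecomposition G r) : HasForestsDecomposition G s := by
  obtain ⟨F, hF, hdisj, rfl⟩ := h
  refine ⟨fun i => if hi : (i : ℕ) < r then F ⟨i, hi⟩ else ⊥, fun i => ?_, fun i j hij => ?_, ?_⟩
  · by_cases hi : (i : ℕ) < r
    · simpa only [dif_pos hi] using hF _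
    · simp only [dif_neg hi, SimpleGraph.isAcyclic_bot]
  · by_cases hi : (i : ℕ) < r
    · by_cases hj : (j : ℕ) < r
      · simp only [dif_pos hi, dif_pos hj]
        exact hdisj _ _ fun h => hij (Fin.ext (by simpa using h))
      · simp only [dif_neg hj, disjoint_bot_right]
    · simp only [dif_neg hi, disjoint_bot_left]
  · refine le_antisymm (iSup_le fun i => ?_) (iSup_le fun i => ?_)
    · by_cases hi : (i : ℕ) < r
      · simp only [dif_pos hi]
        exact le_iSup F _
      · simp only [dif_neg hi, bot_le]
    · refine le_trans ?_ (le_iSup _ (⟨i, by omega⟩ : Fin s))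
      simp

theorem computesHPartition_peelingSubroutine {ε : ℝ} (hε : 0 < ε) {n : ℕ} (a : ℕ) (hn : 2 ≤ n) :
    ComputesHPartition ε (Real.log 2 / Real.log (1 + ε / 2) + 1) n a
      (peelingSubroutine ε n a) := by
  intro G hG
  have hE : peel G ⌊(2 + ε) * a⌋₊ (peelingRounds ε n) = ∅ :=
    peel_eq_empty hε ((hasForestsDecomposition_arboricity G).mono hG)
      (by simpa using lt_pow_peelingRounds hε hn)
  exact ⟨_, _, peelingRounds_le hε hn, isHPartition_peelIndex hE, peelingAlgorithm_computesIn hE⟩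

/-! ### Defective coloring by polynomials over finite fields -/

/-- For every `m` there are `8 ^ m` functions on a set of size `2 ^ m` to itself any two of which
agree in at most two points: the polynomials of degree at most two over the field of that size. -/
theorem exists_functions_agree_le_two (m : ℕ) : ∃ P : ℕ → ℕ → ℕ, (∀ c x, P c x < 2 ^ m) ∧
    ∀ c < 8 ^ m, ∀ c' < 8 ^ m, c ≠ c' → #{x ∈ range (2 ^ m) | P c x = P c' x} ≤ 2 := by
  classical
  -- There is no field of size `2 ^ 0`, but then only the index 0 is allowed and there is nothing to
  -- compare.
  rcases Nat.eq_zero_or_pos m with rfl | hm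
  · exact ⟨fun _ _ => 0, by simp, fun c hc c' hc' h => by simp at hc hc'; omega⟩
  have : Fintype (GaloisField 2 m) := Fintype.ofFinite _
  have hcard : Fintype.card (GaloisField 2 m) = 2 ^ m := by
    rw [← Nat.card_eq_fintype_card, GaloisField.card 2 m hm.ne']
  have hcard3 : Fintype.card (Fin 3 → GaloisField 2 m) = 8 ^ m := by
    rw [Fintype.card_fun, hcard, Fintype.card_fin, ← pow_mul, mul_comm, pow_mul]
    norm_num
  let e := Fintype.equivFinOfCardEq hcard
  let e3 := Fintype.equivFinOfCardEq hcard3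
  let Q : (Fin 3 → GaloisField 2 m) → Polynomial (GaloisField 2 m) := fun f =>
    Polynomial.C (f 0) + Polynomial.C (f 1) * Polynomial.X + Polynomial.C (f 2) * Polynomial.X ^ 2
  have hQdeg : ∀ f, (Q f).natDegree ≤ 2 := fun f => by
    simp only [Q]
    compute_degree
  have hQinj : Function.Injective Q := by
    intro f g hfg
    have h0 := congrArg (fun p => Polynomial.coeff p 0) hfg
    have h1 := congrArg (fun p => Polynomial.coeff p 1) hfg
    have h2 := congrArg (fun p => Polynomial.coeff p 2) hfg
    simp [Q, Polynomial.coeff_X, Polynomial.coeff_C, Polynomial.coeff_X_pow] at h0 h1 h2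
    funext i
    fin_cases i
    · exact h0
    · exact h1
    · exact h2
  have hpos : 0 < 2 ^ m := by positivity
  refine ⟨fun c x => if h : c < 8 ^ m ∧ x < 2 ^ m then
    e ((Q (e3.symm ⟨c, h.1⟩)).eval (e.symm ⟨x, h.2⟩)) else 0, fun c x => ?_,
    fun c hc c' hc' hne => ?_⟩
  · dsimp only
    split_ifs
    · exact Fin.isLt _
    · exact hpos
  · by_contra! h
    let S : Finset (GaloisField 2 m) :=
      {y | (Q (e3.symm ⟨c, hc⟩)).eval y = (Q (e3.symm ⟨c', hc'⟩)).eval y}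
    have hS : 2 < #S := by
      refine h.trans_le (Finset.card_le_card_of_injOn
        (fun x => if hx : x < 2 ^ m then e.symm ⟨x, hx⟩ else 0) ?_ ?_)
      · intro x hx
        simp only [Finset.coe_filter, Finset.mem_range, Set.mem_ofPred_eq] at hx
        obtain ⟨hx, hx'⟩ := hx
        simp only [hc, hc', hx, and_self, dite_true] at hx'
        simp only [hx, dite_true, S, Finset.coe_filter, Finset.mem_univ, true_and]
        exact e.injective (Fin.ext hx')
      · intro x hx y hy hxy
        simp only [Finset.coe_filter, Finset.mem_range, Set.mem_ofPred_eq] at hx hy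
        simp only [hx.1, hy.1, dite_true] at hxy
        simpa using e.symm.injective hxy
    -- Polynomials of degree at most two that agree in three points coincide.
    have hQ := Polynomial.eq_of_natDegree_lt_card_of_eval_eq' _ _ S
      (fun y hy => (Finset.mem_filter.1 hy).2)
      ((max_le (hQdeg _) (hQdeg _)).trans_lt hS)
    have := e3.symm.injective (hQinj hQ)
    exact hne (by simpa using this)

/-- Functions as in `exists_functions_agree_le_two`, for every `m`. -/
noncomputable def sparseFamily (m : ℕ) : ℕ → ℕ → ℕ :=
  (exists_functions_agree_le_two m).choose

theorem sparseFamily_lt (m c x : ℕ) : sparseFamily m c x < 2 ^ m :=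
  (exists_functions_agree_le_two m).choose_spec.1 c x

theorem card_sparseFamily_eq_le (m : ℕ) {c c' : ℕ} (hc : c < 8 ^ m) (hc' : c' < 8 ^ m)
    (h : c ≠ c') :
    #{x ∈ range (2 ^ m) | sparseFamily m c x = sparseFamily m c' x} ≤ 2 :=
  (exists_functions_agree_le_two m).choose_spec.2 c hc c' hc' h

/-- The smallest minimizer of a function on a finite set of numbers lies in that set, and the
minimum is at most the average. -/
theorem sInf_minimizers_spec (s : Finset ℕ) (hs : s.Nonempty) (f : ℕ → ℕ) :
    sInf {x | x ∈ s ∧ ∀ y ∈ s, f x ≤ f y} ∈ s ∧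
      #s * f (sInf {x | x ∈ s ∧ ∀ y ∈ s, f x ≤ f y}) ≤ ∑ y ∈ s, f y := by
  have hmem : sInf {x | x ∈ s ∧ ∀ y ∈ s, f x ≤ f y} ∈ {x | x ∈ s ∧ ∀ y ∈ s, f x ≤ f y} :=
    Nat.sInf_mem (s.exists_min_image f hs)
  refine ⟨hmem.1, ?_⟩
  rw [← smul_eq_mul]
  exact Finset.card_nsmul_le_sum _ _ _ hmem.2

/-- The number of colors in `ms` different from `c` whose function agrees with that of `c` in
the point `x`. -/
noncomputable def conflicts (m c : ℕ) (ms : Multiset ℕ) (x : ℕ) : ℕ :=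
  ms.countP fun c' => c' ≠ c ∧ sparseFamily m c' x = sparseFamily m c x

/-- The point in which a vertex of color `c` evaluates its function. -/
noncomputable def evaluationPoint (m c : ℕ) (ms : Multiset ℕ) : ℕ :=
  sInf {x | x ∈ range (2 ^ m) ∧ ∀ y ∈ range (2 ^ m), conflicts m c ms x ≤ conflicts m c ms y}

/-- The new color of a vertex of color `c` whose neighbors have the colors in `ms`: a point with
few conflicts and the value of its function there. -/
noncomputable def recolor (m c : ℕ) (ms : Multiset ℕ) : ℕ :=
  evaluationPoint m c ms * 2 ^ m + sparseFamily m c (evaluationPoint m c ms)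

theorem evaluationPoint_lt (m c : ℕ) (ms : Multiset ℕ) : evaluationPoint m c ms < 2 ^ m :=
  Finset.mem_range.1 (sInf_minimizers_spec (range (2 ^ m)) (by simp) (conflicts m c ms)).1

theorem recolor_lt (m c : ℕ) (ms : Multiset ℕ) : recolor m c ms < 4 ^ m := by
  have h1 := evaluationPoint_lt m c ms
  have h2 := sparseFamily_lt m c (evaluationPoint m c ms)
  have h3 : 4 ^ m = 2 ^ m * 2 ^ m := by rw [← mul_pow]; norm_num
  rw [h3, recolor]
  nlinarith

/-- Point and value are the two digits of the new color in base `2 ^ m`. -/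
theorem eq_and_eq_of_recolor_eq {m c c' : ℕ} {ms ms' : Multiset ℕ}
    (h : recolor m c ms = recolor m c' ms') :
    evaluationPoint m c ms = evaluationPoint m c' ms' ∧
      sparseFamily m c (evaluationPoint m c ms) =
        sparseFamily m c' (evaluationPoint m c' ms') := by
  have h1 := sparseFamily_lt m c (evaluationPoint m c ms)
  have h2 := sparseFamily_lt m c' (evaluationPoint m c' ms')
  have hpos : 0 < 2 ^ m := by positivity
  unfold recolor at h
  have hx : evaluationPoint m c ms = evaluationPoint m c' ms' := by
    have := congrArg (· / 2 ^ m) h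
    simpa only [mul_comm _ (2 ^ m), Nat.mul_add_div hpos, Nat.div_eq_of_lt h1,
      Nat.div_eq_of_lt h2, add_zero] using this
  refine ⟨hx, ?_⟩
  rw [hx] at h ⊢
  omega

theorem conflicts_map {V : Type*} (m c x : ℕ) (N : Finset V) (f : V → ℕ) :
    conflicts m c (N.val.map f) x =
      #{u ∈ N | f u ≠ c ∧ sparseFamily m (f u) x = sparseFamily m c x} := by
  rw [conflicts, Multiset.countP_map, ← Finset.filter_val, Finset.card_val]

/-- Summed over all `2 ^ m` points, each neighbor causes at most two conflicts, and the chosen point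
is at most average. -/
theorem two_pow_mul_conflicts_le {V : Type*} (m c : ℕ) (N : Finset V) (f : V → ℕ)
    (hc : c < 8 ^ m) (hf : ∀ u, f u < 8 ^ m) :
    2 ^ m * conflicts m c (N.val.map f) (evaluationPoint m c (N.val.map f)) ≤ 2 * #N := by
  classical
  have h := (sInf_minimizers_spec (range (2 ^ m)) (by simp) (conflicts m c (N.val.map f))).2
  rw [Finset.card_range] at h
  refine h.trans ?_
  simp only [conflicts_map, Finset.card_filter]
  rw [Finset.sum_comm, mul_comm, ← smul_eq_mul]
  refine Finset.sum_le_card_nsmul _ _ _ fun u _ => ?_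
  by_cases hu : f u = c
  · simp [hu]
  · simp only [ne_eq, hu, not_false_eq_true, true_and]
    rw [← Finset.card_filter]
    exact card_sparseFamily_eq_le m (hf u) hc hu

/-- A neighbor with the same new color has used the same point. So either its old color was already
equal, or it is one of the conflicts counted at that point. -/
theorem two_pow_mul_card_recolor_eq_le {V : Type*} (m : ℕ) (N : V → Finset V) (f : V → ℕ)
    (hf : ∀ u, f u < 8 ^ m) (v : V) :
    2 ^ m * #{u ∈ N v | recolor m (f u) ((N u).val.map f) = recolor m (f v) ((N v).val.map f)} ≤
      2 ^ m * #{u ∈ N v | f u = f v} + 2 * #(N v) := by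
  classical
  refine le_trans ?_ (Nat.add_le_add_left
    (two_pow_mul_conflicts_le m (f v) (N v) f (hf v) hf) _)
  rw [← Nat.mul_add, conflicts_map]
  refine Nat.mul_le_mul_left _ ((Finset.card_le_card fun u hu => ?_).trans
    (Finset.card_union_le _ _))
  obtain ⟨hu, h⟩ := Finset.mem_filter.1 hu
  obtain ⟨h1, h2⟩ := eq_and_eq_of_recolor_eq h
  rw [h1] at h2
  by_cases hc : f u = f v
  · exact Finset.mem_union_left _ (Finset.mem_filter.2 ⟨hu, hc⟩)
  · exact Finset.mem_union_right _ (Finset.mem_filter.2 ⟨hu, hc, h2⟩)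

/-- Starting from the identity numbers, recolor the vertices `J` times, with the parameters
`s + J - 1, …, s`. A state consists of the number of remaining rounds and the current color. -/
noncomputable def iteratedRecoloring (n s J : ℕ) : LocalAlgorithm n Unit ℕ where
  State := ℕ × ℕ
  Msg := ℕ
  init v _ := (J, v)
  send s := s.2
  receive
    | (0, c), _ => (0, c)
    | (r + 1, c), ms => (r, recolor (s + r) c ms)
  output
    | (0, c) => some (c + 1)
    | (_ + 1, _) => none
  output_irrevocable := by
    rintro ⟨_ | r, c⟩ ms o h
    · exact h
    · simp at h

-- The invariant after `i` rounds, with `r` remaining: the colors fit the next family of `8 ^ (s + r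
-- - 1)` polynomials, and the defect is at most `4 * Δ / 2 ^ (s + r)`. The bound `4 ^ (s + r)` needs
-- `0 < i`, since the identity numbers may exceed it.
open Classical in
theorem run_iteratedRecoloring {n s J Δ : ℕ} (hs : 3 ≤ s) (hn : n ≤ 8 ^ (s + J - 1))
    {G : SimpleGraph (Fin n)} (hΔ : ∀ v, #(G.neighborFinset v) ≤ Δ) (i r : ℕ) (hir : i + r = J) :
    ∃ f : Fin n → ℕ, (∀ v, (iteratedRecoloring n s J).run G (fun _ => ()) i v = (r, f v)) ∧
      (∀ v, f v < 8 ^ (s + r - 1)) ∧ (0 < i → ∀ v, f v < 4 ^ (s + r)) ∧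
      ∀ v, 2 ^ (s + r) * #{u ∈ G.neighborFinset v | f u = f v} ≤ 4 * Δ := by
  induction i generalizing r with
  | zero =>
    obtain rfl : r = J := by omega
    refine ⟨fun v => v, fun v => rfl, fun v => v.2.trans_le hn, fun h => absurd h (lt_irrefl 0),
      fun v => ?_⟩
    rw [Finset.filter_eq_empty_iff.2]
    · simp
    · intro u hu h
      rw [SimpleGraph.mem_neighborFinset] at hu
      exact hu.ne (Fin.ext h.symm)
  | succ i ih =>
    obtain ⟨f, hrun, hlt, -, hdef⟩ := ih (r + 1) (by omega)
    have hlt' : ∀ v, f v < 8 ^ (s + r) := hlt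
    have h4 : ∀ v, recolor (s + r) (f v) ((G.neighborFinset v).val.map f) < 4 ^ (s + r) :=
      fun v => recolor_lt _ _ _
    refine ⟨fun v => recolor (s + r) (f v) ((G.neighborFinset v).val.map f), fun v => ?_,
      fun v => (h4 v).trans_le ?_, fun _ => h4, fun v => ?_⟩
    · simp only [LocalAlgorithm.run, hrun]
      rfl
    -- The exponents satisfy `2 (s + r) ≤ 3 (s + r - 1)` because `s ≥ 3`.
    · rw [show 4 = 2 ^ 2 by rfl, show 8 = 2 ^ 3 by rfl, ← pow_mul, ← pow_mul]
      exact Nat.pow_le_pow_right (by norm_num) (by omega)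
    -- The old defect, weighted by `2 ^ (s + r)`, is at most half of `4 * Δ`, and the recoloring
    -- adds at most `2 * Δ`.
    · have h1 := two_pow_mul_card_recolor_eq_le (s + r) (fun v => G.neighborFinset v) f hlt' v
      have h2 := hdef v
      have h3 := hΔ v
      rw [← add_assoc, pow_succ] at h2
      refine h1.trans ?_
      nlinarith

theorem iteratedRecoloring_computesIn {n s J Δ m : ℕ} (hs : 3 ≤ s) (hJ : 0 < J)
    (hn : n ≤ 8 ^ (s + J - 1)) {G : SimpleGraph (Fin n)}
    (hΔ : ∀ v, (G.neighborSet v).ncard ≤ Δ) (hm : ∀ x, 2 ^ s * x ≤ 4 * Δ → x ≤ m) :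
    ∃ ψ, IsDefectiveColoring G m (4 ^ s) ψ ∧
      (iteratedRecoloring n s J).ComputesIn G (fun _ => ()) J ψ := by
  classical
  have hΔ' : ∀ v, #(G.neighborFinset v) ≤ Δ := fun v => by
    rw [← Set.ncard_coe_finset, SimpleGraph.coe_neighborFinset]
    exact hΔ v
  obtain ⟨f, hrun, -, hlt, hdef⟩ := run_iteratedRecoloring hs hn hΔ' J 0 rfl
  refine ⟨fun v => f v + 1, ⟨fun v => ?_, fun v => ?_⟩, fun v => ?_⟩
  · have := hlt hJ v
    simp only [Finset.mem_Icc, add_zero] at this ⊢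
    omega
  · refine hm _ (le_trans (le_of_eq ?_) (hdef v))
    rw [add_zero, ← Set.ncard_coe_finset]
    congr 2
    ext u
    simp
  · rw [hrun]
    rfl

/-- The last parameter used for recoloring. -/
noncomputable def recoloringLevel (ε : ℝ) (t : ℕ) : ℕ := Nat.clog 2 ⌈4 * (2 + ε) * t⌉₊

theorem le_two_pow_recoloringLevel (ε : ℝ) (t : ℕ) :
    4 * (2 + ε) * t ≤ 2 ^ recoloringLevel ε t := by
  refine (Nat.le_ceil _).trans ?_
  exact_mod_cast Nat.le_pow_clog (by norm_num) _

/-- With `X = 4 (2 + ε) t ≥ 8`, rounding up to an integer and then to a power of two gives less than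
`2 (X + 1) ≤ 5 X / 2`. -/
theorem two_pow_recoloringLevel_le {ε : ℝ} (hε : 0 < ε) {t : ℕ} (ht : 0 < t) :
    (2 : ℝ) ^ recoloringLevel ε t ≤ 10 * (2 + ε) * t := by
  have ht' : (1 : ℝ) ≤ t := by exact_mod_cast ht
  have h8 : 8 ≤ 4 * (2 + ε) * t := by nlinarith
  have h1 : 1 < ⌈4 * (2 + ε) * t⌉₊ := by
    rw [Nat.lt_ceil]
    push_cast
    linarith
  have h2 := Nat.pow_pred_clog_lt_self (b := 2) (by norm_num) h1
  have h3 := Nat.ceil_lt_add_one (show 0 ≤ 4 * (2 + ε) * t by linarith)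
  have h4 : 0 < recoloringLevel ε t := Nat.clog_pos (by norm_num) h1
  obtain ⟨s, hs⟩ : ∃ s, recoloringLevel ε t = s + 1 := ⟨_, (Nat.succ_pred_eq_of_pos h4).symm⟩
  have h5 : (2 : ℝ) ^ s < ⌈4 * (2 + ε) * t⌉₊ := by
    have h6 : Nat.clog 2 ⌈4 * (2 + ε) * t⌉₊ = s + 1 := hs
    rw [h6] at h2
    exact_mod_cast h2
  rw [hs, pow_succ]
  linarith

theorem three_le_recoloringLevel {ε : ℝ} (hε : 0 < ε) {t : ℕ} (ht : 0 < t) :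
    3 ≤ recoloringLevel ε t := by
  have ht' : (1 : ℝ) ≤ t := by exact_mod_cast ht
  have h : (2 : ℝ) ^ 3 ≤ 2 ^ recoloringLevel ε t := by
    refine le_trans ?_ (le_two_pow_recoloringLevel ε t)
    nlinarith
  exact (pow_le_pow_iff_right₀ (by norm_num : (1 : ℝ) < 2)).1 h

/-- The subroutine that computes a defective coloring. -/
noncomputable def recoloringSubroutine (ε : ℝ) (n t : ℕ) : Subroutine n ℕ :=
  ⟨iteratedRecoloring n (recoloringLevel ε t) (Nat.log 2 n + 1), Nat.log 2 n + 1⟩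

theorem recoloringSubroutine_rounds_le (ε : ℝ) {n : ℕ} (t : ℕ) (hn : 2 ≤ n) :
    ((recoloringSubroutine ε n t).rounds : ℝ) ≤ 2 * Real.logb 2 n := by
  have h1 := one_le_logb_two hn
  have h2 := Real.natLog_le_logb n 2
  simp only [recoloringSubroutine]
  push_cast at h2 ⊢
  linarith

/-- The level is chosen so that `2 ^ s ≥ 4 (2 + ε) t`, which brings the defect `4 ⌊(2 + ε) a⌋ / 2 ^
s` down to `a / t`; the number of colors is `4 ^ s = (2 ^ s) ^ 2`. -/
theorem computesDefectiveColoring_recoloringSubroutine {ε : ℝ} (hε : 0 < ε) (n a : ℕ) {t : ℕ}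
    (ht : 0 < t) :
    ComputesDefectiveColoring ε (100 * (2 + ε) ^ 2) n a t (recoloringSubroutine ε n t) := by
  intro G hG
  have hs := three_le_recoloringLevel hε ht
  have hn : n ≤ 8 ^ (recoloringLevel ε t + (Nat.log 2 n + 1) - 1) := by
    refine (Nat.lt_pow_succ_log_self (b := 2) (by norm_num) n).le.trans ?_
    exact (Nat.pow_le_pow_left (by norm_num) _).trans
      (Nat.pow_le_pow_right (by norm_num) (by omega))
  obtain ⟨ψ, hψ, hc⟩ := iteratedRecoloring_computesIn (m := a / t) hs (Nat.succ_pos _) hn hG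
    fun x hx => by
      rw [Nat.le_div_iff_mul_le ht]
      have h1 : (2 : ℝ) ^ recoloringLevel ε t * x ≤ 4 * ⌊(2 + ε) * a⌋₊ := by exact_mod_cast hx
      have h2 : (⌊(2 + ε) * a⌋₊ : ℝ) ≤ (2 + ε) * a := Nat.floor_le (by positivity)
      have h3 := mul_le_mul_of_nonneg_right (le_two_pow_recoloringLevel ε t) (Nat.cast_nonneg x)
      have h4 : (4 * (2 + ε)) * ((x : ℝ) * t) ≤ (4 * (2 + ε)) * a := by linarith
      exact_mod_cast le_of_mul_le_mul_left h4 (by positivity)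
  refine ⟨_, ψ, ?_, hψ, hc⟩
  have h1 := two_pow_recoloringLevel_le hε ht
  have h2 : ((4 ^ recoloringLevel ε t : ℕ) : ℝ) = (2 ^ recoloringLevel ε t) ^ 2 := by
    push_cast
    rw [← pow_mul, mul_comm, pow_mul]
    norm_num
  rw [h2]
  calc ((2 : ℝ) ^ recoloringLevel ε t) ^ 2 ≤ (10 * (2 + ε) * t) ^ 2 :=
        pow_le_pow_left₀ (by positivity) h1 2
    _ = _ := by ring

/-! ### Procedure Simple-Arbdefective -/

theorem leastUsed_mem {k : ℕ} (hk : 0 < k) (used : Multiset ℕ) :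
    leastUsed k used ∈ Finset.Icc 1 k :=
  (sInf_minimizers_spec (Finset.Icc 1 k) ⟨1, Finset.mem_Icc.2 ⟨le_rfl, hk⟩⟩
    fun c => used.count c).1

theorem mul_count_leastUsed_le {k : ℕ} (hk : 0 < k) (used : Multiset ℕ) :
    k * used.count (leastUsed k used) ≤ used.card := by
  have h := (sInf_minimizers_spec (Finset.Icc 1 k) ⟨1, Finset.mem_Icc.2 ⟨le_rfl, hk⟩⟩
    fun c => used.count c).2
  rw [Nat.card_Icc, Nat.add_sub_cancel] at h
  -- Enlarging the range by all colors that occur makes the counts add up to the cardinality.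
  refine h.trans ((Finset.sum_le_sum_of_subset (Finset.subset_union_left
    (s₂ := used.toFinset))).trans (le_of_eq ?_))
  exact Multiset.sum_count_eq_card fun a ha =>
    Finset.mem_union_right _ (Multiset.mem_toFinset.2 ha)

section SimpleArbdefective

variable {n k : ℕ} {G : SimpleGraph (Fin n)} {P : Fin n → Finset (Fin n)}

-- A vertex selects only when all its parents have; by `hφ` the selections it sees agree with `φ`.
open Classical in
theorem selectColor_eq_some {N S : Finset (Fin n)} (hSN : S ⊆ N) (o : Fin n → Option ℕ)
    (φ : Fin n → ℕ) (hφ : ∀ u c, o u = some c → φ u = c) {c : ℕ}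
    (h : selectColor k S (N.val.map fun u => (u, o u)) = some c) :
    c = leastUsed k (S.val.map φ) := by
  unfold selectColor at h
  split_ifs at h with hall
  have ho : ∀ p ∈ S, o p = some (φ p) := by
    intro p hp
    obtain ⟨c, hc⟩ := hall p hp
    obtain ⟨u, -, hu⟩ := Multiset.mem_map.1 hc
    obtain ⟨rfl, hu2⟩ := Prod.mk.inj hu
    rw [hu2, hφ u c hu2]
  rw [← Option.some.inj h, Multiset.filterMap_map]
  congr 1
  have h1 : S = N.filter (· ∈ S) := by
    ext u
    simp only [Finset.mem_filter]
    exact ⟨fun hu => ⟨hSN hu, hu⟩, fun hu => hu.2⟩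
  have h2 : S.val.map φ = (N.val.filter (· ∈ S)).map φ := by
    rw [← Finset.filter_val, ← h1]
  rw [h2, ← Multiset.filterMap_ite_some]
  congr 1
  funext u
  by_cases hu : u ∈ S
  · simp [hu, ho u hu]
  · simp [hu]

/-- The selection, if any, that a vertex has made after a number of rounds. -/
noncomputable def selection (k : ℕ) (G : SimpleGraph (Fin n)) (P : Fin n → Finset (Fin n)) (r : ℕ)
    (v : Fin n) : Option ℕ :=
  (simpleArbdefective n k).output ((simpleArbdefective n k).run G P r v)

theorem run_simpleArbdefective (r : ℕ) (v : Fin n) :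
    (simpleArbdefective n k).run G P r v = (v, P v, selection k G P r v) := by
  classical
  induction r generalizing v with
  | zero => rfl
  | succ r ih =>
    have h : (simpleArbdefective n k).run G P (r + 1) v =
      (simpleArbdefective n k).receive (v, P v, selection k G P r v)
        ((G.neighborFinset v).val.map fun u => (u, selection k G P r u)) := by
      simp only [LocalAlgorithm.run, ih]
      rfl
    rw [selection, h]
    cases selection k G P r v <;> rfl

open Classical in
theorem selection_succ_of_eq_none {r : ℕ} {v : Fin n} (h : selection k G P r v = none) :
    selection k G P (r + 1) v =
      selectColor k (P v) ((G.neighborFinset v).val.map fun u => (u, selection k G P r u)) := by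
  rw [selection]
  simp only [LocalAlgorithm.run, run_simpleArbdefective, h]
  rfl

theorem selection_mono {r r' : ℕ} (hr : r ≤ r') {v : Fin n} {c : ℕ}
    (h : selection k G P r v = some c) : selection k G P r' v = some c :=
  LocalAlgorithm.output_run_mono _ _ _ hr h

/-- After `r` rounds all vertices of potential at least `R - r` have selected, because a vertex
waits only for parents of greater potential. -/
theorem selection_isSome (hP : ∀ v, ∀ u ∈ P v, G.Adj v u) (f : Fin n → ℕ)
    (hf : ∀ v, ∀ u ∈ P v, f v < f u) {R : ℕ} (hR : ∀ v, f v ≤ R) (r : ℕ) (v : Fin n)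
    (h : R ≤ f v + r) : (selection k G P r v).isSome := by
  classical
  induction r generalizing v with
  | zero =>
    have hPv : P v = ∅ := Finset.eq_empty_of_forall_notMem fun u hu => by
      have := hf v u hu
      have := hR u
      omega
    simp [selection, LocalAlgorithm.run, simpleArbdefective, selectColor, hPv]
  | succ r ih =>
    cases hs : selection k G P r v with
    | some c => rw [selection_mono (Nat.le_succ r) hs]; rfl
    | none =>
      rw [selection_succ_of_eq_none hs, selectColor, if_pos]
      · rfl
      · intro p hp
        have := hf v p hp
        obtain ⟨c, hc⟩ := Option.isSome_iff_exists.1 (ih p (by omega))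
        exact ⟨c, Multiset.mem_map.2 ⟨p, by simpa using hP v p hp, by rw [hc]⟩⟩

/-- Selections are never revoked, so a choice made from the parents' selections at any time is a
choice with respect to the final coloring `φ`. -/
theorem selection_eq_leastUsed (hP : ∀ v, ∀ u ∈ P v, G.Adj v u) {R : ℕ} (φ : Fin n → ℕ)
    (hφ : ∀ v c, selection k G P R v = some c → φ v = c) (r : ℕ) (hr : r ≤ R) (v : Fin n) (c : ℕ)
    (h : selection k G P r v = some c) : c = leastUsed k ((P v).val.map φ) := by
  classical
  induction r with
  | zero =>
    -- Initially no message has arrived, so only a vertex without parents can have selected.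
    refine selectColor_eq_some (N := ∅) (o := fun _ => none) (fun u hu => ?_) φ (by simp) h
    by_contra
    change selectColor k (P v) 0 = some c at h
    unfold selectColor at h
    split_ifs at h with hall
    obtain ⟨c, hc⟩ := hall u hu
    simp at hc
  | succ r ih =>
    cases hs : selection k G P r v with
    | some c' =>
      rw [selection_mono (Nat.le_succ r) hs] at h
      exact ih (by omega) (hs.trans h)
    | none =>
      rw [selection_succ_of_eq_none hs] at h
      exact selectColor_eq_some (fun u hu => by simpa using hP v u hu) _ φ
        (fun u c hu => hφ u c (selection_mono (by omega) hu)) h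

theorem simpleArbdefective_computesIn (hk : 0 < k) (hP : ∀ v, ∀ u ∈ P v, G.Adj v u)
    (f : Fin n → ℕ) (hf : ∀ v, ∀ u ∈ P v, f v < f u) {R : ℕ} (hR : ∀ v, f v ≤ R) :
    ∃ φ, (simpleArbdefective n k).ComputesIn G P R φ ∧ (∀ v, φ v ∈ Finset.Icc 1 k) ∧
      ∀ v, k * #{u ∈ P v | φ u = φ v} ≤ #(P v) := by
  classical
  have hsome : ∀ v, ∃ c, selection k G P R v = some c := fun v =>
    Option.isSome_iff_exists.1 (selection_isSome hP f hf hR R v (by omega))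
  choose φ hφ using hsome
  have hleast : ∀ v, φ v = leastUsed k ((P v).val.map φ) := fun v =>
    selection_eq_leastUsed hP φ (fun u c hu => Option.some.inj ((hφ u).symm.trans hu)) R le_rfl v _
      (hφ v)
  refine ⟨φ, hφ, fun v => ?_, fun v => ?_⟩
  · rw [hleast v]
    exact leastUsed_mem hk _
  · have h := mul_count_leastUsed_le hk ((P v).val.map φ)
    rw [← hleast, Multiset.count_map, Multiset.card_map] at h
    rw [Finset.card_def, Finset.filter_val]
    simpa only [eq_comm, Finset.card_val] using h

end SimpleArbdefective

/-! ### Arboricity of the color classes and the final bounds -/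

theorem card_lexParents_le {V : Type*} [Fintype V] {G : SimpleGraph V} {ℓ d : ℕ} {h : V → ℕ}
    (hh : IsHPartition G ℓ d h) (ψ : V → ℕ) (v : V) :
    #(lexParents G (fun v => (h v, ψ v)) v) ≤ d := by
  refine le_trans ?_ (hh.2 v)
  rw [← Set.ncard_coe_finset]
  refine Set.ncard_le_ncard (fun u hu => ?_) (Set.toFinite _)
  simp only [lexParents, Finset.coe_filter, Finset.mem_univ, true_and, Set.mem_ofPred_eq] at hu ⊢
  exact ⟨hu.1, by omega⟩

/-- If every vertex has at most `q` parents of its own color and at most `m` neighbors that agree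
with it in all three of the H-index, the defective color and the color, then the color classes have
arboricity at most `q + m`. -/
theorem arboricity_induce_le {V : Type*} [Fintype V] [LinearOrder V] {G : SimpleGraph V}
    {h ψ φ : V → ℕ} {q m p : ℕ} (hψ : IsDefectiveColoring (G.withinClasses h) m p ψ)
    (hq : ∀ v, #{u ∈ lexParents G (fun v => (h v, ψ v)) v | φ u = φ v} ≤ q) (i : ℕ) :
    arboricity (G.induce {v | φ v = i}) ≤ q + m := by
  classical
  -- The last component breaks ties, which orients the unoriented edges acyclically.
  let ρ : {v | φ v = i} → ℕ ×ₗ ℕ ×ₗ V := fun v => toLex (h v, toLex (ψ v, (v : V)))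
  refine arboricity_le_of_injective _ _ ρ (fun x y hxy => ?_) fun v => ?_
  · have := congrArg (fun z => (ofLex (ofLex z).2).2) hxy
    exact Subtype.ext this
  · rw [← Set.ncard_image_of_injective _ Subtype.val_injective]
    refine le_trans ?_ (Nat.add_le_add (hq v) (hψ.2 v))
    rw [← Set.ncard_coe_finset]
    refine le_trans (Set.ncard_le_ncard ?_ (Set.toFinite _)) (Set.ncard_union_le _ _)
    rintro _ ⟨u, ⟨hadj, hlt⟩, rfl⟩
    have hadj' : G.Adj v u := hadj
    have huv : φ u = φ v := u.2.trans v.2.symm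
    simp only [ρ, Prod.Lex.toLex_lt_toLex] at hlt
    simp only [lexParents, Set.mem_union, Finset.coe_filter, Finset.mem_filter, Finset.mem_univ,
      true_and, Set.mem_ofPred_eq]
    rcases hlt with h1 | ⟨h1, h2 | ⟨h2, -⟩⟩
    · exact Or.inl ⟨⟨hadj', Or.inl h1⟩, huv⟩
    · exact Or.inl ⟨⟨hadj', Or.inr ⟨h1, h2⟩⟩, huv⟩
    · exact Or.inr ⟨⟨hadj', h1⟩, h2.symm⟩

/-- Procedure Arbdefective-Coloring with arbitrary subroutines, on a graph on which these are
correct. -/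
theorem arbdefectiveColoring_computesIn {n k d m ℓ p : ℕ} (hk : 0 < k)
    {hPart defCol : Subroutine n ℕ} {G : SimpleGraph (Fin n)} {h ψ : Fin n → ℕ}
    (hh : IsHPartition G ℓ d h) (hhc : hPart.Computes G h)
    (hψ : IsDefectiveColoring (G.withinClasses h) m p ψ)
    (hψc : defCol.Computes (G.withinClasses h) ψ) :
    ∃ φ, (arbdefectiveColoring hPart defCol k).ComputesIn G (fun _ => ())
        (hPart.rounds + defCol.rounds + 1 + ℓ * p) φ ∧
      IsArbdefectiveColoring G (d / k + m) k φ := by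
  have hmem : ∀ v u, u ∈ lexParents G (fun v => (h v, ψ v)) v →
      G.Adj v u ∧ (h v < h u ∨ (h v = h u ∧ ψ v < ψ u)) := fun v u hu => by
    simpa [lexParents] using hu
  -- The potential numbers the pairs (H-index, defective color) lexicographically from 1 to `ℓ * p`.
  obtain ⟨φ, hφ, hφk, hφq⟩ := simpleArbdefective_computesIn (k := k) hk
    (fun v u hu => (hmem v u hu).1) (fun v => (h v - 1) * p + ψ v) (R := ℓ * p)
    (fun v u hu => by
      have h1 := Finset.mem_Icc.1 (hh.1 v)
      have h2 := Finset.mem_Icc.1 (hψ.1 v)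
      have h3 := Finset.mem_Icc.1 (hψ.1 u)
      rcases (hmem v u hu).2 with h4 | ⟨h4, h5⟩
      · have h6 : (h v - 1 + 1) * p ≤ (h u - 1) * p := Nat.mul_le_mul_right _ (by omega)
        rw [add_mul, one_mul] at h6
        omega
      · rw [h4]
        omega)
    (fun v => by
      have h1 := Finset.mem_Icc.1 (hh.1 v)
      have h2 := Finset.mem_Icc.1 (hψ.1 v)
      have h6 : (h v - 1 + 1) * p ≤ ℓ * p := Nat.mul_le_mul_right _ (by omega)
      rw [add_mul, one_mul] at h6
      omega)
  refine ⟨φ, (partialOrientation_computesIn hhc hψc).seq hφ, hφk, fun i _ =>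
    arboricity_induce_le hψ (fun v => ?_) i⟩
  rw [Nat.le_div_iff_mul_le hk, mul_comm]
  exact (hφq v).trans (card_lexParents_le hh ψ v)

theorem mainTheorem4 (ε : ℝ) (hε : 0 < ε) :
    ∃ (c C : ℝ) (hPart : ∀ n _a : ℕ, Subroutine n ℕ) (defCol : ∀ n _a _t : ℕ, Subroutine n ℕ),
      (∀ n a : ℕ, 2 ≤ n → ComputesHPartition ε c n a (hPart n a)) ∧
      (∀ n a t : ℕ, 2 ≤ n → 0 < t → ComputesDefectiveColoring ε c n a t (defCol n a t)) ∧
      ∀ n a k t : ℕ, 2 ≤ n → 0 < k → 0 < t →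
        ∀ G : SimpleGraph (Fin n), arboricity G ≤ a →
          ∃ (r : ℕ) (φ : Fin n → ℕ),
            (r : ℝ) ≤ C * (t : ℝ) ^ 2 * Real.logb 2 n ∧
            (arbdefectiveColoring (hPart n a) (defCol n a t) k).ComputesIn G (fun _ => ()) r φ ∧
            IsArbdefectiveColoring G ⌊(a : ℝ) / t + (2 + ε) * a / k⌋₊ k φ := by
  set c₁ := Real.log 2 / Real.log (1 + ε / 2) + 1
  set c₂ := 100 * (2 + ε) ^ 2
  have h₁ : 0 ≤ c₁ := by
    have := Real.log_nonneg (show (1 : ℝ) ≤ 1 + ε / 2 by linarith)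
    have := Real.log_nonneg (show (1 : ℝ) ≤ 2 by norm_num)
    positivity
  have h₂ : 0 ≤ c₂ := by positivity
  -- With `L = log n`, the rounds are at most `c₁ L` for peeling, `2 L` for recoloring, `1 ≤ L` for
  -- orienting and `c₁ L * c₂ t²` for waiting.
  refine ⟨c₁ + c₂, c₁ + 3 + c₁ * c₂, peelingSubroutine ε, fun n _ t => recoloringSubroutine ε n t,
    fun n a hn G hG => ?_, fun n a t hn ht G hG => ?_, fun n a k t hn hk ht G hG => ?_⟩
  · obtain ⟨ℓ, h, hℓ, hh⟩ := computesHPartition_peelingSubroutine hε a hn G hG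
    have := one_le_logb_two hn
    exact ⟨ℓ, h, hℓ.trans (mul_le_mul_of_nonneg_right (by linarith) (by linarith)), hh⟩
  · obtain ⟨p, ψ, hp, hψ⟩ := computesDefectiveColoring_recoloringSubroutine hε n a ht G hG
    exact ⟨p, ψ, hp.trans (mul_le_mul_of_nonneg_right (by linarith) (by positivity)), hψ⟩
  · obtain ⟨ℓ, h, hℓ, hh, hhc⟩ := computesHPartition_peelingSubroutine hε a hn G hG
    -- Neighbors in the same H-set are among those counted by the H-partition, so the degree
    -- condition holds.
    obtain ⟨p, ψ, hp, hψ, hψc⟩ := computesDefectiveColoring_recoloringSubroutine hε n a ht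
      (G.withinClasses h) fun v => le_trans
        (Set.ncard_le_ncard (t := {u | G.Adj v u ∧ h v ≤ h u})
          (fun u hu => ⟨hu.1, hu.2.le⟩) (Set.toFinite _)) (hh.2 v)
    obtain ⟨φ, hφ, hφk, hφa⟩ := arbdefectiveColoring_computesIn hk hh hhc hψ hψc
    -- The arboricity bound is an integer, so it suffices to compare it with the real number under
    -- the floor.
    refine ⟨_, φ, ?_, hφ, hφk, fun i hi => (hφa i hi).trans (Nat.le_floor ?_)⟩
    · have hL := one_le_logb_two hn
      have hr₁ : ((peelingSubroutine ε n a).rounds : ℝ) ≤ c₁ * Real.logb 2 n :=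
        peelingRounds_le hε hn
      have hr₂ := recoloringSubroutine_rounds_le ε t hn
      have ht' : (1 : ℝ) ≤ (t : ℝ) ^ 2 := one_le_pow₀ (by exact_mod_cast ht)
      have hprod : (ℓ : ℝ) * p ≤ c₁ * Real.logb 2 n * (c₂ * (t : ℝ) ^ 2) :=
        mul_le_mul hℓ hp (Nat.cast_nonneg _) (by positivity)
      have hlin : (c₁ + 3) * Real.logb 2 n ≤ (c₁ + 3) * Real.logb 2 n * (t : ℝ) ^ 2 :=
        le_mul_of_one_le_right (by positivity) ht'
      push_cast
      linarith
    · have hd : (⌊(2 + ε) * a⌋₊ : ℝ) ≤ (2 + ε) * a := Nat.floor_le (by positivity)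
      have h1 : ((⌊(2 + ε) * a⌋₊ / k : ℕ) : ℝ) ≤ (2 + ε) * a / k :=
        Nat.cast_div_le.trans (div_le_div_of_nonneg_right hd (Nat.cast_nonneg _))
      have h2 : ((a / t : ℕ) : ℝ) ≤ a / t := Nat.cast_div_le
      push_cast
      linarith
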